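/- **Setting.** Let $M>0$. Let $d$ be a complex random variable which is symmetric ($d$ and $-d$ have the same law) with $$\mathbb E\,d=0,\quad \mathbb E\,d^2=0,\quad \mathbb E|d|^4=2\bigl(\mathbb E|d|^2\bigr)^2,\quad |d|\le M\ \text{a.s.},$$ and let $d_1,\dots,d_L\in\mathbb C^n$ be random masks all of whose entries are independent copies of $d$. For a real signal $x_0\in\mathbb R^n$ one observes $$y_{k,l}=\Bigl|\sum_{t=0}^{n-1}x_0(t)\,\overline{d_l(t)}\,e^{-2\pi i kt/n}\Bigr|^2+w_{k,l},\qquad 1\le k\le n,\ 1\le l\le L,$$ where the noises $w_{k,l}\sim\mathcal N(0,\sigma^2)$, $\sigma>0$, are independent and independent of the masks. Put $\mathrm{dist}(x,x_0)=\min\{\|x-x_0\|,\|x+x_0\|\}$ (Euclidean norm). An estimator is a measurable function $\hat x=\hat x(y)$ with values in $\mathbb R^n$; it may depend on the masks. **Theorem.** There is a constant $c_0>0$ depending only on $M$ such that the following holds. For every $C_0>0$, every integer $k_0\ge1$ and every $\varepsilon>0$ there is $n_0$, depending only on $M,C_0,k_0,\varepsilon$, such that for all $n\ge n_0$, all $1\le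 L\le C_0\log^{k_0}n$, all $\sigma>0$ and all $d$ as above, with probability at least $1-\varepsilon$ over the masks: 1. $$\inf_{\hat x}\ \sup_{x_0\in\mathbb R^n,\ \|x_0\|\ge\sigma}\ \|x_0\|\;\mathbb E\bigl[\mathrm{dist}(\hat x,x_0)\,\big|\,\{d_l\}_{l=1}^L\bigr]\ \ge\ \frac{c_0\,\sigma}{\sqrt L\,\log n};$$ 2. if moreover $n\ge e^{1/\sigma}$ (which holds for fixed $\sigma$ once $n$ is large), then for every $r\ge\sigma$ $$\inf_{\hat x}\ \sup_{x_0\in\mathbb R^n,\ \|x_0\|=r}\ \mathbb E\bigl[\mathrm{dist}(\hat x,x_0)\,\big|\,\{d_l\}_{l=1}^L\bigr]\ \ge\ \frac{c_0\,\sigma}{\sqrt L\,\log n\; r}.$$ The infima are over all estimators. -/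

import Mathlib

open MeasureTheory ProbabilityTheory
open scoped ENNReal

/-- The law `μ` of the complex random variable `d` from which the masks are generated: `d` is
symmetric (`d` and `-d` have the same law), `E d = 0`, `E d² = 0`, `E |d|⁴ = 2 (E |d|²)²`
and `|d| ≤ M` almost surely. -/
structure IsMaskLaw (μ : Measure ℂ) (M : ℝ) : Prop where
  prob : IsProbabilityMeasure μ
  symmetric : μ.map (fun z => -z) = μ
  mean_zero : ∫ z, z ∂μ = 0
  mean_sq_zero : ∫ z, z ^ 2 ∂μ = 0
  fourth_moment : ∫ z, ‖z‖ ^ 4 ∂μ = 2 * (∫ z, ‖z‖ ^ 2 ∂μ) ^ 2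
  bounded : ∀ᵐ z ∂μ, ‖z‖ ≤ M

/-- The random masks `d_1, …, d_L ∈ ℂⁿ` (`d l t` is the `t`-th entry of the `l`-th mask): all the
entries are independent and have the law `μ`. -/
structure IsRandomMasks {Ω : Type*} [MeasurableSpace Ω] (P : Measure Ω) {n L : ℕ}
    (d : Fin L → Fin n → Ω → ℂ) (μ : Measure ℂ) : Prop where
  law : ∀ l t, HasLaw (d l t) μ P
  indep : iIndepFun (fun p : Fin L × Fin n => d p.1 p.2) P

/-- The noiseless measurements `|⟨D_l f_k, x⟩|² = |∑ₜ x(t) conj(d_l(t)) exp(-2πi k t / n)|²` of a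
real signal `x`. The frequency `k` runs through `0, …, n - 1`, i.e. through all residues
modulo `n`. -/
noncomputable def cdpIntensity {n L : ℕ} (d : Fin L → Fin n → ℂ) (x : EuclideanSpace ℝ (Fin n)) :
    Fin n × Fin L → ℝ :=
  fun p => ‖∑ t : Fin n, (x t : ℂ) * (starRingEnd ℂ) (d p.2 t) *
    Complex.exp (-(2 * Real.pi * Complex.I * (p.1 : ℕ) * (t : ℕ) / n))‖ ^ 2

/-- The law of the noise vector: independent entries `w_{k,l} ∼ N(0, σ²)`. -/
noncomputable def gaussianNoise (n L : ℕ) (σ : ℝ) : Measure (Fin n × Fin L → ℝ) :=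
  Measure.pi fun _ => gaussianReal 0 ⟨σ ^ 2, sq_nonneg σ⟩

/-- The distance up to a global sign. -/
noncomputable def signDist {n : ℕ} (x y : EuclideanSpace ℝ (Fin n)) : ℝ :=
  min ‖x - y‖ ‖x + y‖

/-- The risk `E[dist(x̂(y), x₀) | d_1, …, d_L]` for the observation `y_{k,l} = |⟨D_l f_k, x₀⟩|² +
w_{k,l}`, given the realization `d` of the masks: the expectation is over the noise, which is
independent of the masks. It takes values in `[0, ∞]`. -/
noncomputable def condRisk {n L : ℕ} (d : Fin L → Fin n → ℂ) (σ : ℝ)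
    (xhat : (Fin n × Fin L → ℝ) → EuclideanSpace ℝ (Fin n)) (x₀ : EuclideanSpace ℝ (Fin n)) :
    ℝ≥0∞ :=
  ∫⁻ w, ENNReal.ofReal (signDist (xhat (cdpIntensity d x₀ + w)) x₀) ∂(gaussianNoise n L σ)

/-! This is Assouad's method on a cube inside the sphere of radius `r`: one coordinate equals a
large `a`, the others are `± δ`. Flipping one sign moves the intensity at `(k, l)` by `4⟨F, b⟩`,
where `F` is the transform of the masked midpoint and `|b| ≤ δM`. By Parseval the squared shift of
the whole mean vector is at most `16 δ² M⁴ n L r²` (`sum_cdpIntensity_sub_sq_le`). If this is at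
most `2σ²`, no test tells the two vertices apart (`gaussianNoise_two_point`). An average vertex then
leaves a fixed fraction of the signs wrong, at a cost of order `δ√n`, which is of order `σ / (√L log
n · r)` for the `δ` chosen in `minimax_le_iSup_condRisk`.

The global sign does not help the estimator: since `a ≥ δ√n`, a wrong sign at the large coordinate
costs as much as getting all the small ones wrong (`signErrors_le_signDist`).

The factor `log n` only shrinks `δ` so that the cube fits in the sphere, for which `σ ≤ r² log n`
suffices. The masks enter through `‖d‖ ≤ M`, so the event has probability one. -/

/-! ### Two-point testing bound for Gaussian product measures -/

/-- A product of probability measures with densities is the product measure with the product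
density. -/
lemma pi_withDensity_eq {ι : Type*} [Fintype ι] {X : ι → Type*} [∀ i, MeasurableSpace (X i)]
    (μ : ∀ i, Measure (X i)) [∀ i, IsProbabilityMeasure (μ i)] (f : ∀ i, X i → ℝ≥0∞)
    (hf : ∀ i, Measurable (f i)) [∀ i, SigmaFinite ((μ i).withDensity (f i))] :
    Measure.pi (fun i => (μ i).withDensity (f i)) =
      (Measure.pi μ).withDensity (fun x => ∏ i, f i (x i)) := by
  classical
  refine (Measure.pi_eq ?_)
  intro s hs
  rw [withDensity_apply _ (MeasurableSet.univ_pi hs),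
    ← lintegral_indicator (MeasurableSet.univ_pi hs)]
  have h1 : ∀ x : ∀ i, X i, (Set.univ.pi s).indicator (fun x => ∏ i, f i (x i)) x =
      ∏ i, (s i).indicator (f i) (x i) := by
    intro x
    by_cases hx : x ∈ Set.univ.pi s
    · rw [Set.indicator_of_mem hx]
      refine Finset.prod_congr rfl fun i _ => ?_
      rw [Set.indicator_of_mem (hx i (Set.mem_univ i))]
    · rw [Set.indicator_of_notMem hx]
      simp only [Set.mem_univ_pi, not_forall] at hx
      obtain ⟨i, hi⟩ := hx
      exact (Finset.prod_eq_zero (Finset.mem_univ i) (Set.indicator_of_notMem hi _)).symm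
  simp_rw [h1]
  have hm : ∀ i, Measurable ((s i).indicator (f i)) := fun i => (hf i).indicator (hs i)
  have hind : iIndepFun (fun i (x : ∀ i, X i) => (s i).indicator (f i) (x i)) (Measure.pi μ) :=
    iIndepFun_pi fun i => (hm i).aemeasurable
  rw [lintegral_prod_eq_prod_lintegral_of_indepFun Finset.univ _ hind
    fun i => (hm i).comp (measurable_pi_apply i)]
  refine Finset.prod_congr rfl fun i _ => ?_
  rw [(measurePreserving_eval μ i).lintegral_comp (hm i), lintegral_indicator (hs i),
    withDensity_apply _ (hs i)]

lemma gaussianReal_add_eq_withDensity (m a : ℝ) {v : NNReal} (hv : v ≠ 0) :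
    gaussianReal (m + a) v = (gaussianReal m v).withDensity
      (fun x => ENNReal.ofReal (Real.exp ((a * (x - m) - a ^ 2 / 2) / v))) := by
  rw [gaussianReal_of_var_ne_zero _ hv, gaussianReal_of_var_ne_zero _ hv,
    ← withDensity_mul _ (measurable_gaussianPDF _ _) (by fun_prop)]
  congr 1
  funext x
  have hv' : (v : ℝ) ≠ 0 := by exact_mod_cast hv
  simp only [Pi.mul_apply, gaussianPDF]
  rw [← ENNReal.ofReal_mul (gaussianPDFReal_nonneg _ _ _)]
  congr 1
  simp only [gaussianPDFReal_def]
  rw [mul_assoc _ (Real.exp _), ← Real.exp_add]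
  congr 2
  field_simp
  ring

/-- Le Cam's two-point bound for densities `f`, `g` whose product is a constant `ρ²`. -/
lemma one_le_two_point {X : Type*} [MeasurableSpace X] (μ : Measure X) [IsProbabilityMeasure μ]
    {f g : X → ℝ} (hf0 : ∀ x, 0 ≤ f x) (hg0 : ∀ x, 0 ≤ g x) (hf : Measurable f)
    (hg : Measurable g)
    [hPf : IsProbabilityMeasure (μ.withDensity fun x => ENNReal.ofReal (f x))]
    [hPg : IsProbabilityMeasure (μ.withDensity fun x => ENNReal.ofReal (g x))] {ρ : ℝ}
    (hρ : 3 / 4 ≤ ρ) (hfg : ∀ x, f x * g x = ρ ^ 2) {A : Set X} (hA : MeasurableSet A) :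
    ENNReal.ofReal (1 / 4) ≤ (μ.withDensity fun x => ENNReal.ofReal (f x)) A +
      (μ.withDensity fun x => ENNReal.ofReal (g x)) Aᶜ := by
  -- AM-GM: `(2u + w/8)² = (2u - w/8)² + uw`. The unequal weights keep the unwanted terms `G A` and
  -- `F Aᶜ` small.
  have key : ∀ u w : ℝ, 0 ≤ u → 0 ≤ w → u * w = ρ ^ 2 →
      ENNReal.ofReal ρ ≤ 2 * ENNReal.ofReal u + ENNReal.ofReal (1 / 8) * ENNReal.ofReal w := by
    intro u w hu hw h
    rw [← ENNReal.ofReal_mul (by norm_num), ← ENNReal.ofReal_ofNat 2,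
      ← ENNReal.ofReal_mul (by norm_num), ← ENNReal.ofReal_add (by positivity) (by positivity)]
    apply ENNReal.ofReal_le_ofReal
    have : ρ ^ 2 ≤ (2 * u + 1 / 8 * w) ^ 2 := by
      rw [← h]; nlinarith [sq_nonneg (2 * u - 1 / 8 * w)]
    exact (abs_le_of_sq_le_sq' this (by positivity)).2
  set F := μ.withDensity fun x => ENNReal.ofReal (f x)
  set G := μ.withDensity fun x => ENNReal.ofReal (g x)
  have hle : ∀ (B : Set X) (_ : MeasurableSet B) (u w : X → ℝ), (∀ x, 0 ≤ u x) → (∀ x, 0 ≤ w x) →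
      Measurable u → Measurable w → (∀ x, u x * w x = ρ ^ 2) →
      ENNReal.ofReal ρ * μ B ≤ 2 * (μ.withDensity fun x => ENNReal.ofReal (u x)) B +
        ENNReal.ofReal (1 / 8) * (μ.withDensity fun x => ENNReal.ofReal (w x)) B := by
    intro B hB u w hu hw hum hwm h
    rw [withDensity_apply _ hB, withDensity_apply _ hB, ← setLIntegral_const,
      ← lintegral_const_mul _ (by fun_prop), ← lintegral_const_mul _ (by fun_prop),
      ← lintegral_add_left (by fun_prop)]
    exact lintegral_mono fun x => key _ _ (hu x) (hw x) (h x)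
  have h1 := hle A hA f g hf0 hg0 hf hg hfg
  have h2 := hle Aᶜ hA.compl g f hg0 hf0 hg hf fun x => by rw [mul_comm]; exact hfg x
  have conv : ∀ (ν : Measure X) [IsProbabilityMeasure ν] (B : Set X),
      ν B = ENNReal.ofReal (ν.real B) := fun ν _ B => (ofReal_measureReal).symm
  rw [conv F A, conv G Aᶜ, ← ENNReal.ofReal_add (by positivity) (by positivity)]
  apply ENNReal.ofReal_le_ofReal
  change _ ≤ 2 * F A + _ * G A at h1
  change _ ≤ 2 * G Aᶜ + _ * F Aᶜ at h2
  have real : ∀ a b c : ℝ, 0 ≤ a → 0 ≤ b → 0 ≤ c →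
      ENNReal.ofReal ρ * ENNReal.ofReal a ≤
        2 * ENNReal.ofReal b + ENNReal.ofReal (1 / 8) * ENNReal.ofReal c →
      ρ * a ≤ 2 * b + 1 / 8 * c := by
    intro a b c ha hb hc h
    rw [← ENNReal.ofReal_mul (by linarith), ← ENNReal.ofReal_ofNat 2,
      ← ENNReal.ofReal_mul (by norm_num), ← ENNReal.ofReal_mul (by norm_num),
      ← ENNReal.ofReal_add (by positivity) (by positivity)] at h
    exact (ENNReal.ofReal_le_ofReal_iff (by positivity)).1 h
  rw [conv μ, conv F, conv G] at h1
  rw [conv μ, conv F, conv G] at h2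
  have h1' := real _ _ _ (by positivity) (by positivity) (by positivity) h1
  have h2' := real _ _ _ (by positivity) (by positivity) (by positivity) h2
  have hc := fun (ν : Measure X) [IsProbabilityMeasure ν] => probReal_compl_eq_one_sub (μ := ν) hA
  simp only [hc] at h2' ⊢
  have := measureReal_nonneg (μ := F) (s := A)
  have := measureReal_le_one (μ := G) (s := A)
  -- With `s = F A + G Aᶜ`, adding `h1'` and `h2'` gives `ρ ≤ 2s + (2 - s)/8`, so `s ≥ 4/15` when `ρ
  -- ≥ 3/4`.
  nlinarith

/-- Relative to the Gaussian centred at the midpoint `m`, the two laws are shifts by `a` and `-a`.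
The linear terms cancel in the product of their densities, leaving the constant `exp (-∑ aᵢ² / v)`.
-/
lemma gaussian_two_point {ι : Type*} [Fintype ι] (θ θ' : ι → ℝ) {v : NNReal} (hv : v ≠ 0)
    (hθ : ∑ i, (θ i - θ' i) ^ 2 ≤ 2 * v) {A : Set (ι → ℝ)} (hA : MeasurableSet A) :
    ENNReal.ofReal (1 / 4) ≤ Measure.pi (fun i => gaussianReal (θ i) v) A +
      Measure.pi (fun i => gaussianReal (θ' i) v) Aᶜ := by
  have hv' : (0 : ℝ) < v := by exact_mod_cast pos_iff_ne_zero.2 hv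
  let m : ι → ℝ := fun i => (θ i + θ' i) / 2
  let dens : (ι → ℝ) → (ι → ℝ) → ℝ :=
    fun a x => ∏ i, Real.exp ((a i * (x i - m i) - a i ^ 2 / 2) / v)
  have hdens : ∀ a : ι → ℝ, Measure.pi (fun i => gaussianReal (m i + a i) v) =
      (Measure.pi fun i => gaussianReal (m i) v).withDensity
        fun x => ENNReal.ofReal (dens a x) := by
    intro a
    have h := fun i => gaussianReal_add_eq_withDensity (m i) (a i) hv
    have : ∀ i, IsProbabilityMeasure ((gaussianReal (m i) v).withDensity
        (fun x => ENNReal.ofReal (Real.exp ((a i * (x - m i) - a i ^ 2 / 2) / v)))) :=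
      fun i => h i ▸ inferInstance
    simp_rw [h]
    rw [pi_withDensity_eq _ _ fun i => by fun_prop]
    congr 1
    funext x
    exact (ENNReal.ofReal_prod_of_nonneg fun i _ => (Real.exp_pos _).le).symm
  let a : ι → ℝ := fun i => (θ i - θ' i) / 2
  have e1 : θ = fun i => m i + a i := by funext i; simp only [m, a]; ring
  have e2 : θ' = fun i => m i + (-a) i := by funext i; simp only [m, a, Pi.neg_apply]; ring
  have p1 : Measure.pi (fun i => gaussianReal (θ i) v) = _ :=
    (congrArg (fun t : ι → ℝ => Measure.pi (fun i => gaussianReal (t i) v)) e1).trans (hdens a)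
  have p2 : Measure.pi (fun i => gaussianReal (θ' i) v) = _ :=
    (congrArg (fun t : ι → ℝ => Measure.pi (fun i => gaussianReal (t i) v)) e2).trans (hdens (-a))
  have i1 : IsProbabilityMeasure ((Measure.pi fun i => gaussianReal (m i) v).withDensity
      fun x => ENNReal.ofReal (dens a x)) := p1 ▸ inferInstance
  have i2 : IsProbabilityMeasure ((Measure.pi fun i => gaussianReal (m i) v).withDensity
      fun x => ENNReal.ofReal (dens (-a) x)) := p2 ▸ inferInstance
  rw [p1, p2]
  have hm : ∀ b, Measurable (dens b) := fun b => by fun_prop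
  have h0 : ∀ b x, 0 ≤ dens b x := fun b x => Finset.prod_nonneg fun i _ => (Real.exp_pos _).le
  refine one_le_two_point _ (h0 a) (h0 (-a)) (hm a) (hm (-a))
    (ρ := Real.exp (-(∑ i, a i ^ 2) / (2 * v))) ?_ ?_ hA
  -- The exponent is at least `-1/4`, and `1 + x ≤ exp x` then gives `ρ ≥ 3/4`.
  · have h1 : ∑ i, a i ^ 2 ≤ v / 2 := by
      have : ∑ i, a i ^ 2 = (∑ i, (θ i - θ' i) ^ 2) / 4 := by
        rw [Finset.sum_div]; exact Finset.sum_congr rfl fun i _ => by simp only [a]; ring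
      rw [this]; linarith
    have h2 : -(1 / 4) ≤ -(∑ i, a i ^ 2) / (2 * v) := by
      rw [le_div_iff₀ (by positivity)]; linarith
    linarith [Real.add_one_le_exp (-(∑ i, a i ^ 2) / (2 * v))]
  · intro x
    simp only [dens]
    rw [← Finset.prod_mul_distrib, ← Real.exp_nat_mul]
    simp_rw [← Real.exp_add]
    rw [← Real.exp_sum]
    congr 1
    rw [mul_div_assoc', ← Finset.sum_neg_distrib, Finset.mul_sum, Finset.sum_div]
    refine Finset.sum_congr rfl fun i _ => ?_
    simp only [Pi.neg_apply]
    push_cast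
    field_simp
    ring

lemma map_add_pi_gaussianReal {ι : Type*} [Fintype ι] (v : NNReal) (θ : ι → ℝ) :
    (Measure.pi fun _ => gaussianReal 0 v).map (fun w => θ + w) =
      Measure.pi fun i => gaussianReal (θ i) v := by
  have h := fun i => gaussianReal_map_const_add (μ := 0) (v := v) (θ i)
  have := Measure.pi_map_pi (μ := fun _ : ι => gaussianReal 0 v)
    (f := fun i x => θ i + x) (hμ := fun i => by rw [h]; infer_instance)
    (fun i => by fun_prop)
  simp only [h, zero_add] at this
  exact this

lemma gaussian_shift_two_point {ι : Type*} [Fintype ι] (θ θ' : ι → ℝ) {v : NNReal} (hv : v ≠ 0)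
    (hθ : ∑ i, (θ i - θ' i) ^ 2 ≤ 2 * v) {A : Set (ι → ℝ)} (hA : MeasurableSet A) :
    ENNReal.ofReal (1 / 4) ≤ Measure.pi (fun _ => gaussianReal 0 v) {w | θ + w ∈ A} +
      Measure.pi (fun _ => gaussianReal 0 v) {w | θ' + w ∉ A} := by
  have h := gaussian_two_point θ θ' hv hθ hA
  rw [← map_add_pi_gaussianReal v θ, ← map_add_pi_gaussianReal v θ',
    Measure.map_apply (by fun_prop) hA, Measure.map_apply (by fun_prop) hA.compl] at h
  exact h

lemma gaussianNoise_two_point {n L : ℕ} {σ : ℝ} (hσ : 0 < σ) (θ θ' : Fin n × Fin L → ℝ)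
    (hθ : ∑ i, (θ i - θ' i) ^ 2 ≤ 2 * σ ^ 2) {A : Set (Fin n × Fin L → ℝ)}
    (hA : MeasurableSet A) :
    ENNReal.ofReal (1 / 4) ≤ gaussianNoise n L σ {w | θ + w ∈ A} +
      gaussianNoise n L σ {w | θ' + w ∉ A} :=
  gaussian_shift_two_point θ θ' (v := (⟨σ ^ 2, sq_nonneg σ⟩ : NNReal))
    (fun h => (pow_pos hσ 2).ne' (congrArg NNReal.toReal h)) hθ hA

/-! ### Sensitivity of the intensities to one coordinate -/

/-- Parseval's identity for the discrete Fourier transform on `Fin n`. -/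
lemma sum_norm_sq_dft {n : ℕ} (z : Fin n → ℂ) :
    ∑ k : Fin n, ‖∑ t : Fin n, z t *
      Complex.exp (-(2 * Real.pi * Complex.I * (k : ℕ) * (t : ℕ) / n))‖ ^ 2 =
      n * ∑ t, ‖z t‖ ^ 2 := by
  rcases Nat.eq_zero_or_pos n with rfl | hn
  · simp
  have hn0 : (n : ℂ) ≠ 0 := by exact_mod_cast hn.ne'
  set ζ : ℂ := Complex.exp (2 * Real.pi * Complex.I / n) with hζ
  have hprim : IsPrimitiveRoot ζ n := Complex.isPrimitiveRoot_exp n hn.ne'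
  have hζ0 : ζ ≠ 0 := Complex.exp_ne_zero _
  have hexp : ∀ k t : Fin n, Complex.exp (-(2 * Real.pi * Complex.I * (k : ℕ) * (t : ℕ) / n)) =
      ((ζ ^ (t : ℕ))⁻¹) ^ (k : ℕ) := by
    intro k t
    rw [hζ, ← Complex.exp_nat_mul, ← Complex.exp_neg, ← Complex.exp_nat_mul]
    congr 1
    ring
  have hconj : ∀ m : ℕ, (starRingEnd ℂ) ((ζ ^ m)⁻¹) = ζ ^ m := by
    intro m
    have h1 : ‖ζ ^ m‖ = 1 := by rw [norm_pow, hprim.norm'_eq_one hn.ne', one_pow]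
    rw [← Complex.inv_eq_conj (by rw [norm_inv, h1, inv_one]), inv_inv]
  have horth : ∀ s t : Fin n, ∑ k : Fin n, ((ζ ^ (t : ℕ))⁻¹ * ζ ^ (s : ℕ)) ^ (k : ℕ) =
      if s = t then (n : ℂ) else 0 := by
    intro s t
    rw [Fin.sum_univ_eq_sum_range fun k => ((ζ ^ (t : ℕ))⁻¹ * ζ ^ (s : ℕ)) ^ k]
    split_ifs with h
    · subst h
      simp [inv_mul_cancel₀ (pow_ne_zero _ hζ0)]
    · have hne : (ζ ^ (t : ℕ))⁻¹ * ζ ^ (s : ℕ) ≠ 1 := by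
        intro h1
        rw [inv_mul_eq_one₀ (pow_ne_zero _ hζ0)] at h1
        exact h (Fin.ext (hprim.pow_inj t.2 s.2 h1).symm)
      rw [geom_sum_eq hne, mul_pow, inv_pow, ← pow_mul, ← pow_mul, mul_comm (t : ℕ),
        mul_comm (s : ℕ), pow_mul, pow_mul, hprim.pow_eq_one]
      simp
  have hC : (((∑ k : Fin n, ‖∑ t : Fin n, z t *
      Complex.exp (-(2 * Real.pi * Complex.I * (k : ℕ) * (t : ℕ) / n))‖ ^ 2 : ℝ)) : ℂ) =
      ((n * ∑ t, ‖z t‖ ^ 2 : ℝ) : ℂ) := by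
    push_cast
    simp_rw [← Complex.mul_conj', hexp, map_sum, map_mul, map_pow, hconj, Finset.sum_mul_sum]
    rw [Finset.sum_comm, Finset.mul_sum]
    refine Finset.sum_congr rfl fun t _ => ?_
    rw [Finset.sum_comm]
    have : ∀ s : Fin n, ∑ k : Fin n, z t * (ζ ^ (t : ℕ))⁻¹ ^ (k : ℕ) *
        ((starRingEnd ℂ) (z s) * (ζ ^ (s : ℕ)) ^ (k : ℕ)) =
        if s = t then z t * (starRingEnd ℂ) (z t) * n else 0 := by
      intro s
      have hs : (if s = t then z t * (starRingEnd ℂ) (z t) * n else 0) =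
          z t * (starRingEnd ℂ) (z s) * if s = t then (n : ℂ) else 0 := by
        split_ifs with h
        · rw [h]
        · simp
      rw [hs, ← horth s t, Finset.mul_sum]
      refine Finset.sum_congr rfl fun k _ => ?_
      rw [mul_pow]
      ring
    simp_rw [this]
    simp [mul_comm]
  exact_mod_cast hC

/-- Polarization followed by Cauchy–Schwarz. -/
lemma norm_add_sq_sub_norm_sub_sq_le (a b : ℂ) :
    (‖a + b‖ ^ 2 - ‖a - b‖ ^ 2) ^ 2 ≤ 16 * (‖a‖ ^ 2 * ‖b‖ ^ 2) := by
  have h1 : ‖a + b‖ ^ 2 - ‖a - b‖ ^ 2 = 4 * inner ℝ a b := by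
    rw [norm_add_sq_real, norm_sub_sq_real]; ring
  have h2 := abs_real_inner_le_norm a b
  have h3 : (inner ℝ a b) ^ 2 ≤ (‖a‖ * ‖b‖) ^ 2 := by
    rw [← sq_abs]; gcongr
  rw [h1]
  linarith [h3, mul_pow ‖a‖ ‖b‖ 2, mul_pow 4 (inner ℝ a b) 2]

/-- Two signals that differ in one coordinate have close intensities. -/
lemma sum_cdpIntensity_sub_sq_le {n L : ℕ} {d : Fin L → Fin n → ℂ} {M : ℝ}
    (hd : ∀ l t, ‖d l t‖ ≤ M) (u : EuclideanSpace ℝ (Fin n)) (t₀ : Fin n) (δ : ℝ) :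
    ∑ p, (cdpIntensity d (u + EuclideanSpace.single t₀ δ) p -
      cdpIntensity d (u - EuclideanSpace.single t₀ δ) p) ^ 2 ≤
      16 * δ ^ 2 * M ^ 4 * n * L * ‖u‖ ^ 2 := by
  let e : Fin n → Fin n → ℂ := fun k t =>
    Complex.exp (-(2 * Real.pi * Complex.I * (k : ℕ) * (t : ℕ) / n))
  let F : Fin L → Fin n → ℂ := fun l k => ∑ t, (u t : ℂ) * (starRingEnd ℂ) (d l t) * e k t
  have he : ∀ k t, ‖e k t‖ = 1 := by
    intro k t
    have : -(2 * Real.pi * Complex.I * (k : ℕ) * (t : ℕ) / n : ℂ) =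
        ((-(2 * Real.pi * (k : ℕ) * (t : ℕ) / n) : ℝ) : ℂ) * Complex.I := by push_cast; ring
    simp only [e]
    rw [this, Complex.norm_exp_ofReal_mul_I]
  have hM : ∀ l t, ‖d l t‖ ^ 2 ≤ M ^ 2 := fun l t => by gcongr; exact hd l t
  have hF : ∀ l, ∑ k, ‖F l k‖ ^ 2 ≤ n * (M ^ 2 * ‖u‖ ^ 2) := by
    intro l
    rw [sum_norm_sq_dft fun t => (u t : ℂ) * (starRingEnd ℂ) (d l t), EuclideanSpace.norm_sq_eq,
      Finset.mul_sum (a := M ^ 2)]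
    gcongr with t
    rw [norm_mul, mul_pow, RCLike.norm_conj, Complex.norm_real, mul_comm]
    exact mul_le_mul_of_nonneg_right (hM l t) (sq_nonneg _)
  have hpt : ∀ p : Fin n × Fin L, (cdpIntensity d (u + EuclideanSpace.single t₀ δ) p -
      cdpIntensity d (u - EuclideanSpace.single t₀ δ) p) ^ 2 ≤
      16 * δ ^ 2 * M ^ 2 * ‖F p.2 p.1‖ ^ 2 := by
    rintro ⟨k, l⟩
    have hs : ∑ t, ((EuclideanSpace.single t₀ δ : EuclideanSpace ℝ (Fin n)) t : ℂ) *
        (starRingEnd ℂ) (d l t) * e k t = δ * (starRingEnd ℂ) (d l t₀) * e k t₀ := by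
      rw [Finset.sum_eq_single t₀]
      · simp
      · intro t _ ht; simp [ht]
      · simp
    have h1 : cdpIntensity d (u + EuclideanSpace.single t₀ δ) (k, l) =
        ‖F l k + δ * (starRingEnd ℂ) (d l t₀) * e k t₀‖ ^ 2 := by
      rw [← hs, ← Finset.sum_add_distrib]
      simp only [cdpIntensity, PiLp.add_apply, Complex.ofReal_add, add_mul, e]
    have h2 : cdpIntensity d (u - EuclideanSpace.single t₀ δ) (k, l) =
        ‖F l k - δ * (starRingEnd ℂ) (d l t₀) * e k t₀‖ ^ 2 := by
      rw [← hs, ← Finset.sum_sub_distrib]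
      simp only [cdpIntensity, PiLp.sub_apply, Complex.ofReal_sub, sub_mul, e]
    rw [h1, h2]
    refine (norm_add_sq_sub_norm_sub_sq_le _ _).trans ?_
    rw [norm_mul, norm_mul, he, RCLike.norm_conj, Complex.norm_real, mul_one, mul_pow,
      Real.norm_eq_abs, sq_abs]
    have := mul_le_mul_of_nonneg_left (hM l t₀)
      (by positivity : 0 ≤ 16 * ‖F l k‖ ^ 2 * δ ^ 2)
    linarith
  calc _ ≤ ∑ p : Fin n × Fin L, 16 * δ ^ 2 * M ^ 2 * ‖F p.2 p.1‖ ^ 2 :=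
        Finset.sum_le_sum fun p _ => hpt p
    _ = 16 * δ ^ 2 * M ^ 2 * ∑ l, ∑ k, ‖F l k‖ ^ 2 := by
        rw [← Finset.mul_sum, Fintype.sum_prod_type, Finset.sum_comm]
    _ ≤ 16 * δ ^ 2 * M ^ 2 * ∑ _l : Fin L, (n * (M ^ 2 * ‖u‖ ^ 2) : ℝ) := by
        gcongr with l; exact hF l
    _ = _ := by simp; ring

/-! ### The sign cube and the distance up to sign -/

/-- The vector with entry `a` at `i₀` and entries `± δ`, with the signs given by `e`, elsewhere. -/
noncomputable def cubePoint {n : ℕ} (i₀ : Fin n) (a δ : ℝ) (e : Fin n → Bool) :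
    EuclideanSpace ℝ (Fin n) :=
  WithLp.toLp 2 fun t => if t = i₀ then a else if e t then δ else -δ

section cubePoint
variable {n : ℕ} (i₀ : Fin n) (a δ : ℝ) (e : Fin n → Bool)

lemma cubePoint_apply (t : Fin n) :
    cubePoint i₀ a δ e t = if t = i₀ then a else if e t then δ else -δ := rfl

lemma norm_cubePoint_sq : ‖cubePoint i₀ a δ e‖ ^ 2 = a ^ 2 + (n - 1) * δ ^ 2 := by
  have hn : 1 ≤ n := Nat.one_le_iff_ne_zero.2 fun h => by subst h; exact i₀.elim0
  rw [EuclideanSpace.norm_sq_eq, ← Finset.add_sum_erase _ _ (Finset.mem_univ i₀)]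
  rw [Finset.sum_congr rfl (g := fun _ => δ ^ 2)]
  · simp [cubePoint_apply, Nat.cast_sub hn]
  · intro t ht
    simp only [cubePoint_apply, Finset.ne_of_mem_erase ht, if_false]
    split_ifs <;> simp

/-- The coordinates other than `i₀` at which the signs of `z` differ from those of `e`. -/
noncomputable def signErrors (z : EuclideanSpace ℝ (Fin n)) : Finset (Fin n) :=
  (Finset.univ.erase i₀).filter fun t => ¬ (e t = true ↔ 0 ≤ z t)

/-- Trades the square root for a quantity linear in the number of errors, whose expectation is a sum
of error probabilities. -/
lemma card_signErrors_div_le (z : EuclideanSpace ℝ (Fin n)) :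
    ((signErrors i₀ e z).card : ℝ) / √n ≤ √((signErrors i₀ e z).card) := by
  have hn : 0 < n := i₀.pos
  have h : ((signErrors i₀ e z).card : ℝ) ≤ n := by
    exact_mod_cast (Finset.card_le_univ _).trans (by simp)
  rw [div_le_iff₀ (by positivity), ← Real.sqrt_mul (by positivity)]
  apply Real.le_sqrt_of_sq_le
  rw [sq]
  gcongr

lemma signErrors_le_norm_sub {δ : ℝ} (hδ : 0 ≤ δ) (z : EuclideanSpace ℝ (Fin n)) :
    δ * ((signErrors i₀ e z).card / √n) ≤ ‖z - cubePoint i₀ a δ e‖ := by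
  refine (mul_le_mul_of_nonneg_left (card_signErrors_div_le i₀ e z) hδ).trans ?_
  rw [EuclideanSpace.norm_eq]
  apply Real.le_sqrt_of_sq_le
  rw [mul_pow, Real.sq_sqrt (by positivity), mul_comm, ← nsmul_eq_mul, ← Finset.sum_const]
  refine (Finset.sum_le_sum fun t ht => ?_).trans
    (Finset.sum_le_sum_of_subset_of_nonneg (Finset.subset_univ _) fun t _ _ => by positivity)
  simp only [signErrors, Finset.mem_filter, Finset.mem_erase] at ht
  simp only [PiLp.sub_apply, cubePoint_apply, ht.1.1, if_false, Real.norm_eq_abs, sq_abs]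
  rcases h : e t with _ | _
  · have : 0 ≤ z t := by simpa [h] using ht.2
    simp only [Bool.false_eq_true, if_false]
    nlinarith
  · have : z t < 0 := by simpa [h] using ht.2
    simp only [if_true]
    nlinarith

/-- The coordinate `i₀` alone contributes at least `a ≥ δ√n`, which dominates any error count; hence
`z'` is arbitrary, and is later taken to be `-z`. -/
lemma signErrors_le_norm_sub_of_nonpos {δ a : ℝ} (hδ : 0 ≤ δ) (ha : δ * √n ≤ a)
    (z z' : EuclideanSpace ℝ (Fin n)) (hz : z i₀ ≤ 0) :
    δ * ((signErrors i₀ e z').card / √n) ≤ ‖z - cubePoint i₀ a δ e‖ := by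
  have hn : 0 < n := i₀.pos
  have h : ((signErrors i₀ e z').card : ℝ) ≤ n := by
    exact_mod_cast (Finset.card_le_univ _).trans (by simp)
  have h1 : ((signErrors i₀ e z').card : ℝ) / √n ≤ √n := by
    rw [div_le_iff₀ (by positivity), Real.mul_self_sqrt (by positivity)]
    exact h
  refine ((mul_le_mul_of_nonneg_left h1 hδ).trans ha).trans
    (le_trans ?_ (PiLp.norm_apply_le (z - cubePoint i₀ a δ e) i₀))
  simp only [PiLp.sub_apply, cubePoint_apply, if_true, Real.norm_eq_abs]
  exact le_trans (by linarith) (neg_le_abs _)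

/-- The representative of `± z` whose coordinate at `i₀` is nonnegative. -/
noncomputable def normalizeSign (z : EuclideanSpace ℝ (Fin n)) : EuclideanSpace ℝ (Fin n) :=
  if 0 ≤ z i₀ then z else -z

lemma measurable_normalizeSign : Measurable (normalizeSign i₀) := by
  refine Measurable.ite (measurableSet_le measurable_const ?_) measurable_id measurable_neg
  exact (EuclideanSpace.proj (𝕜 := ℝ) i₀).continuous.measurable

lemma signErrors_le_signDist {δ a : ℝ} (hδ : 0 ≤ δ) (ha : δ * √n ≤ a)
    (z : EuclideanSpace ℝ (Fin n)) :
    δ * ((signErrors i₀ e (normalizeSign i₀ z)).card / √n) ≤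
      signDist z (cubePoint i₀ a δ e) := by
  have hneg : ‖z + cubePoint i₀ a δ e‖ = ‖-z - cubePoint i₀ a δ e‖ := by
    rw [← norm_neg]; congr 1; abel
  rw [signDist, hneg]
  unfold normalizeSign
  split_ifs with h
  · exact le_min (signErrors_le_norm_sub i₀ a e hδ z)
      (signErrors_le_norm_sub_of_nonpos i₀ e hδ ha (-z) z (by simpa using h))
  · exact le_min (signErrors_le_norm_sub_of_nonpos i₀ e hδ ha z (-z) (not_le.1 h).le)
      (signErrors_le_norm_sub i₀ a e hδ (-z))

/-- The cube vertices that differ at `t ≠ i₀` have close intensities. -/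
lemma sum_cdpIntensity_cubePoint_le {L : ℕ} {d : Fin L → Fin n → ℂ} {M r : ℝ}
    (hd : ∀ l t, ‖d l t‖ ≤ M) (hr : a ^ 2 + (n - 1) * δ ^ 2 = r ^ 2) {t : Fin n} (ht : t ≠ i₀)
    {e e' : Fin n → Bool} (he : e t = true) (he' : e' t = false) (hee : ∀ s ≠ t, e s = e' s) :
    ∑ p, (cdpIntensity d (cubePoint i₀ a δ e) p - cdpIntensity d (cubePoint i₀ a δ e') p) ^ 2 ≤
      16 * δ ^ 2 * M ^ 4 * n * L * r ^ 2 := by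
  -- `u` is the midpoint of the two vertices: its entry at `t` is zero.
  set u := cubePoint i₀ a δ e - EuclideanSpace.single t δ with hu
  have h1 : cubePoint i₀ a δ e = u + EuclideanSpace.single t δ := by rw [hu]; abel
  have h2 : cubePoint i₀ a δ e' = u - EuclideanSpace.single t δ := by
    ext s
    by_cases hs : s = t
    · subst hs; simp [hu, cubePoint_apply, ht, he, he']
    · simp [hu, cubePoint_apply, hs, hee s hs]
  have h3 : ‖u‖ ^ 2 ≤ r ^ 2 := by
    rw [← hr, ← norm_cubePoint_sq i₀ a δ e, EuclideanSpace.norm_sq_eq, EuclideanSpace.norm_sq_eq]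
    refine Finset.sum_le_sum fun s _ => ?_
    by_cases hs : s = t
    · subst hs
      simp [hu, cubePoint_apply, ht, he]
      positivity
    · simp [hu, hs]
  rw [h1, h2]
  exact (sum_cdpIntensity_sub_sq_le hd u t δ).trans (by gcongr)

end cubePoint

/-! ### Assouad's averaging over the cube -/

lemma ENNReal.card_mul_le_two_mul_sum {α : Type*} [Fintype α] (τ : Equiv.Perm α) (q : α → ℝ≥0∞)
    {c : ℝ≥0∞} (h : ∀ x, c ≤ q x + q (τ x)) : Fintype.card α * c ≤ 2 * ∑ x, q x := by
  calc (Fintype.card α : ℝ≥0∞) * c = ∑ _x : α, c := by simp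
    _ ≤ ∑ x, (q x + q (τ x)) := Finset.sum_le_sum fun x _ => h x
    _ = 2 * ∑ x, q x := by rw [Finset.sum_add_distrib, Equiv.sum_comp τ q, two_mul]

/-- The involution of the cube that changes the sign at `t`. -/
def flipAt {n : ℕ} (t : Fin n) : Equiv.Perm (Fin n → Bool) :=
  Function.Involutive.toPerm (fun e => Function.update e t (!e t)) fun e => by simp

/-- Assouad's lower bound for signals of norm `r`. -/
lemma le_iSup_condRisk_of_norm_eq {n L : ℕ} (hn : 2 ≤ n) {d : Fin L → Fin n → ℂ} {M σ r δ : ℝ}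
    (hd : ∀ l t, ‖d l t‖ ≤ M) (hσ : 0 < σ) (hr : 0 < r) (hδ : 0 ≤ δ)
    (hδr : 2 * n * δ ^ 2 ≤ r ^ 2) (hδσ : 16 * δ ^ 2 * M ^ 4 * n * L * r ^ 2 ≤ 2 * σ ^ 2)
    {xhat : (Fin n × Fin L → ℝ) → EuclideanSpace ℝ (Fin n)} (hx : Measurable xhat) :
    ENNReal.ofReal (δ * √n / 16) ≤
      ⨆ (x₀ : EuclideanSpace ℝ (Fin n)) (_ : ‖x₀‖ = r), condRisk d σ xhat x₀ := by
  let i₀ : Fin n := ⟨0, by omega⟩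
  have hn1 : (2 : ℝ) ≤ n := by exact_mod_cast hn
  let a : ℝ := √(r ^ 2 - (n - 1) * δ ^ 2)
  have ha2 : a ^ 2 = r ^ 2 - (n - 1) * δ ^ 2 := Real.sq_sqrt (by nlinarith [sq_nonneg δ])
  have hra : a ^ 2 + (n - 1) * δ ^ 2 = r ^ 2 := by linarith
  -- From `2nδ² ≤ r²` follows `a² ≥ (n + 1)δ²`.
  have ha : δ * √n ≤ a := by
    apply Real.le_sqrt_of_sq_le
    rw [mul_pow, Real.sq_sqrt (by positivity)]
    nlinarith [sq_nonneg δ]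
  let x : (Fin n → Bool) → EuclideanSpace ℝ (Fin n) := cubePoint i₀ a δ
  have hxr : ∀ e, ‖x e‖ = r := fun e => by
    rw [← sq_eq_sq₀ (norm_nonneg _) hr.le, norm_cubePoint_sq, hra]
  -- The estimator, normalized at `i₀`, is read as a simultaneous sign test for every coordinate; `B
  -- t e` below is the event that test `t` errs at vertex `e`.
  let A : Fin n → Set (Fin n × Fin L → ℝ) := fun t => {y | 0 ≤ normalizeSign i₀ (xhat y) t}
  have hA : ∀ t, MeasurableSet (A t) := fun t =>
    measurableSet_le measurable_const (((EuclideanSpace.proj (𝕜 := ℝ) t).continuous.measurable.comp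
      (measurable_normalizeSign i₀)).comp hx)
  let G := gaussianNoise n L σ
  let B : Fin n → (Fin n → Bool) → Set (Fin n × Fin L → ℝ) := fun t e =>
    {w | ¬ (e t = true ↔ cdpIntensity d (x e) + w ∈ A t)}
  have hB : ∀ t e, MeasurableSet (B t e) := by
    intro t e
    have h1 : MeasurableSet {w | cdpIntensity d (x e) + w ∈ A t} :=
      (measurable_const_add _) (hA t)
    rcases h : e t with _ | _
    · simpa [B, h] using h1
    · have h2 : B t e = {w | cdpIntensity d (x e) + w ∈ A t}ᶜ := by
        ext w; simp [B, h]
      exact h2 ▸ h1.compl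
  have hrisk : ∀ e, ENNReal.ofReal (δ / √n) * ∑ t ∈ Finset.univ.erase i₀, G (B t e) ≤
      condRisk d σ xhat (x e) := by
    intro e
    have h1 : ∑ t ∈ Finset.univ.erase i₀, G (B t e) =
        ∫⁻ w, ∑ t ∈ Finset.univ.erase i₀, (B t e).indicator 1 w ∂G := by
      rw [lintegral_finsetSum _ fun t _ => measurable_one.indicator (hB t e)]
      exact Finset.sum_congr rfl fun t _ => (lintegral_indicator_one (hB t e)).symm
    rw [h1, ← lintegral_const_mul' _ _ ENNReal.ofReal_ne_top]
    refine lintegral_mono fun w => ?_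
    have h2 : ∑ t ∈ Finset.univ.erase i₀, (B t e).indicator (1 : (Fin n × Fin L → ℝ) → ℝ≥0∞) w =
        ((signErrors i₀ e (normalizeSign i₀ (xhat (cdpIntensity d (x e) + w)))).card : ℝ≥0∞) := by
      classical
      rw [signErrors, Finset.card_filter, Nat.cast_sum]
      refine Finset.sum_congr rfl fun t _ => ?_
      simp only [Set.indicator_apply, B, A, Set.mem_ofPred_eq, Pi.one_apply]
      split_ifs <;> simp
    rw [h2, ← ENNReal.ofReal_natCast, ← ENNReal.ofReal_mul (by positivity)]
    apply ENNReal.ofReal_le_ofReal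
    refine le_trans (le_of_eq ?_) (signErrors_le_signDist i₀ e hδ ha _)
    ring
  have hpair : ∀ t ∈ Finset.univ.erase i₀, ∀ e,
      ENNReal.ofReal (1 / 4) ≤ G (B t e) + G (B t (flipAt t e)) := by
    intro t ht
    have key : ∀ e e' : Fin n → Bool, e t = true → e' t = false → (∀ s ≠ t, e s = e' s) →
        ENNReal.ofReal (1 / 4) ≤ G (B t e) + G (B t e') := by
      intro e e' he he' hee
      have := gaussianNoise_two_point hσ _ _ ((sum_cdpIntensity_cubePoint_le i₀ a δ hd hra
        (Finset.ne_of_mem_erase ht) he he' hee).trans hδσ) (hA t).compl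
      simpa [B, he, he', G, x] using this
    have hne : ∀ (e : Fin n → Bool), ∀ s ≠ t, flipAt t e s = e s := fun e s hs =>
      Function.update_of_ne hs _ _
    have heq : ∀ e : Fin n → Bool, flipAt t e t = !e t := fun e => Function.update_self _ _ _
    intro e
    rcases h : e t with _ | _
    · rw [add_comm]
      exact key _ _ (by rw [heq, h]; rfl) h (hne e)
    · exact key _ _ h (by rw [heq, h]; rfl) fun s hs => (hne e s hs).symm
  set S := ⨆ (x₀ : EuclideanSpace ℝ (Fin n)) (_ : ‖x₀‖ = r), condRisk d σ xhat x₀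
  have hS : ∀ e, condRisk d σ xhat (x e) ≤ S := fun e => le_iSup₂_of_le (x e) (hxr e) le_rfl
  have hN : (Fintype.card (Fin n → Bool) : ℝ≥0∞) ≠ 0 := by simp
  have hN' : (Fintype.card (Fin n → Bool) : ℝ≥0∞) ≠ ⊤ := ENNReal.natCast_ne_top _
  set N := (Fintype.card (Fin n → Bool) : ℝ≥0∞) with hNdef
  have hmain : N * (ENNReal.ofReal (δ / √n) * ((n - 1 : ℕ) * ENNReal.ofReal (1 / 4))) ≤
      N * (2 * S) := by
    calc _ = ENNReal.ofReal (δ / √n) *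
          ∑ t ∈ Finset.univ.erase i₀, N * ENNReal.ofReal (1 / 4) := by
          simp; ring
      _ ≤ ENNReal.ofReal (δ / √n) * ∑ t ∈ Finset.univ.erase i₀, 2 * ∑ e, G (B t e) := by
          refine mul_le_mul_right (Finset.sum_le_sum fun t ht => ?_) _
          exact ENNReal.card_mul_le_two_mul_sum (flipAt t) _ (hpair t ht)
      _ = 2 * ∑ e, ENNReal.ofReal (δ / √n) * ∑ t ∈ Finset.univ.erase i₀, G (B t e) := by
          rw [← Finset.mul_sum, ← Finset.mul_sum, Finset.sum_comm]; ring
      _ ≤ 2 * ∑ _e : Fin n → Bool, S := by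
          gcongr with e
          exact (hrisk e).trans (hS e)
      _ = N * (2 * S) := by
          rw [Finset.sum_const, nsmul_eq_mul, hNdef, Finset.card_univ]; ring
  rw [ENNReal.mul_le_mul_iff_right hN hN'] at hmain
  have h2 : 2 * ENNReal.ofReal (δ * √n / 16) ≤ 2 * S := by
    refine le_trans ?_ hmain
    rw [← ENNReal.ofReal_natCast, ← ENNReal.ofReal_ofNat 2, ← ENNReal.ofReal_mul (by norm_num),
      ← ENNReal.ofReal_mul (by positivity), ← ENNReal.ofReal_mul (by positivity)]
    apply ENNReal.ofReal_le_ofReal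
    -- Uses `n - 1 ≥ n/2`, which is where `2 ≤ n` enters.
    rw [Nat.cast_sub (by omega), Nat.cast_one, div_mul_eq_mul_div, le_div_iff₀ (by positivity)]
    have : √(n : ℝ) * √n = n := Real.mul_self_sqrt (by positivity)
    nlinarith
  exact (ENNReal.mul_le_mul_iff_right (by norm_num) (by norm_num)).1 h2

/-! ### Choice of the cube size and the theorem -/

lemma IsRandomMasks.ae_norm_le {Ω : Type*} [MeasurableSpace Ω] {P : Measure Ω} {n L : ℕ}
    {d : Fin L → Fin n → Ω → ℂ} {μ : Measure ℂ} {M : ℝ} (hd : IsRandomMasks P d μ)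
    (hμ : IsMaskLaw μ M) : ∀ᵐ ω ∂P, ∀ l t, ‖d l t ω‖ ≤ M := by
  rw [ae_all_iff]; intro l
  rw [ae_all_iff]; intro t
  have h := hμ.bounded
  rw [← (hd.law l t).map_eq] at h
  exact ae_of_ae_map (hd.law l t).aemeasurable h

/-- The minimax rate on a sphere whose radius is not too small. -/
lemma minimax_le_iSup_condRisk {n L : ℕ} (hn : 2 ≤ n) (hL : 1 ≤ L) {d : Fin L → Fin n → ℂ}
    {M σ r ℓ : ℝ} (hd : ∀ l t, ‖d l t‖ ≤ M) (hσ : 0 < σ) (hr : 0 < r) (hℓ : 1 ≤ ℓ)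
    (hσr : σ ≤ ℓ * r ^ 2)
    {xhat : (Fin n × Fin L → ℝ) → EuclideanSpace ℝ (Fin n)} (hx : Measurable xhat) :
    ENNReal.ofReal (1 / (48 * (1 + M ^ 2)) * σ / (√(L : ℝ) * ℓ * r)) ≤
      ⨆ (x₀ : EuclideanSpace ℝ (Fin n)) (_ : ‖x₀‖ = r), condRisk d σ xhat x₀ := by
  have hn0 : (0 : ℝ) < n := by exact_mod_cast (by omega : 0 < n)
  have hL1 : (1 : ℝ) ≤ L := by exact_mod_cast hL
  have hL0 : (0 : ℝ) < L := by linarith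
  have hℓ0 : 0 < ℓ := by linarith
  let κ : ℝ := 1 / (3 * (1 + M ^ 2))
  have hκ0 : 0 < κ := by positivity
  -- `κ ≤ 1/3` keeps the cube in the sphere; `κM² ≤ 1/3` makes the squared mean shift at most
  -- `16σ²/9 ≤ 2σ²`.
  have hκ1 : κ ≤ 1 / 3 := by
    apply one_div_le_one_div_of_le (by norm_num); nlinarith [sq_nonneg M]
  have hκM : κ * M ^ 2 ≤ 1 / 3 := by
    simp only [κ]
    rw [div_mul_eq_mul_div, div_le_div_iff₀ (by positivity) (by norm_num)]; linarith
  let δ : ℝ := κ * σ / (√n * √L * ℓ * r)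
  have hδ : 0 ≤ δ := by positivity
  have hδ2 : δ ^ 2 * (n * L * r ^ 2) = κ ^ 2 * (σ / ℓ) ^ 2 := by
    simp only [δ, div_pow, mul_pow, Real.sq_sqrt hn0.le, Real.sq_sqrt hL0.le]
    field_simp
  have hσℓ : σ / ℓ ≤ r ^ 2 := by rw [div_le_iff₀ hℓ0]; linarith
  have hσℓ' : σ / ℓ ≤ σ := div_le_self hσ.le hℓ
  have hσℓ0 : 0 ≤ σ / ℓ := by positivity
  have h1 : 2 * n * δ ^ 2 ≤ r ^ 2 := by
    have : r ^ 2 * (2 * n * δ ^ 2) ≤ r ^ 2 * r ^ 2 := by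
      calc r ^ 2 * (2 * n * δ ^ 2) ≤ L * (r ^ 2 * (2 * n * δ ^ 2)) :=
            le_mul_of_one_le_left (by positivity) hL1
        _ = 2 * (κ ^ 2 * (σ / ℓ) ^ 2) := by rw [← hδ2]; ring
        _ ≤ 2 * ((1 / 3) ^ 2 * (r ^ 2) ^ 2) := by gcongr
        _ ≤ r ^ 2 * r ^ 2 := by nlinarith [sq_nonneg (r ^ 2)]
    exact le_of_mul_le_mul_left this (by positivity)
  have h2 : 16 * δ ^ 2 * M ^ 4 * n * L * r ^ 2 ≤ 2 * σ ^ 2 := by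
    calc 16 * δ ^ 2 * M ^ 4 * n * L * r ^ 2 = 16 * M ^ 4 * (δ ^ 2 * (n * L * r ^ 2)) := by ring
      _ = 16 * (κ * M ^ 2) ^ 2 * (σ / ℓ) ^ 2 := by rw [hδ2]; ring
      _ ≤ 16 * (1 / 3) ^ 2 * σ ^ 2 := by gcongr
      _ ≤ 2 * σ ^ 2 := by nlinarith [sq_nonneg σ]
  refine le_trans (le_of_eq ?_) (le_iSup_condRisk_of_norm_eq hn hd hσ hr hδ h1 h2 hx)
  congr 1
  simp only [δ, κ]
  have : √(n : ℝ) ≠ 0 := by positivity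
  field_simp
  norm_num

theorem theorem1p4 (M : ℝ) (hM : 0 < M) :
    ∃ c₀ : ℝ, 0 < c₀ ∧
      ∀ (C₀ : ℝ) (k : ℕ), 0 < C₀ → 1 ≤ k →
      ∀ ε : ℝ, 0 < ε →
      ∃ n₀ : ℕ, ∀ n : ℕ, n₀ ≤ n →
      ∀ L : ℕ, 1 ≤ L → (L : ℝ) ≤ C₀ * Real.log n ^ k →
      ∀ σ : ℝ, 0 < σ →
      ∀ (μ : Measure ℂ), IsMaskLaw μ M →
      ∀ (Ω : Type*) [MeasurableSpace Ω] (P : Measure Ω) [IsProbabilityMeasure P]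
        (d : Fin L → Fin n → Ω → ℂ), IsRandomMasks P d μ →
      ∃ E : Set Ω, MeasurableSet E ∧ 1 - ε ≤ P.real E ∧
        ∀ ω ∈ E,
          -- the risk over all signals with `‖x₀‖ ≥ σ`, relative to the rate at `x₀`
          (ENNReal.ofReal (c₀ * σ / (√(L : ℝ) * Real.log n)) ≤
            ⨅ (xhat : (Fin n × Fin L → ℝ) → EuclideanSpace ℝ (Fin n)) (_ : Measurable xhat),
              ⨆ (x₀ : EuclideanSpace ℝ (Fin n)) (_ : σ ≤ ‖x₀‖),
                ENNReal.ofReal ‖x₀‖ * condRisk (fun l t => d l t ω) σ xhat x₀) ∧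
          -- the risk at each prescribed norm `r ≥ σ`, for `n ≥ exp (1 / σ)`
          (1 ≤ σ * Real.log n →
            ∀ r : ℝ, σ ≤ r →
              ENNReal.ofReal (c₀ * σ / (√(L : ℝ) * Real.log n * r)) ≤
                ⨅ (xhat : (Fin n × Fin L → ℝ) → EuclideanSpace ℝ (Fin n)) (_ : Measurable xhat),
                  ⨆ (x₀ : EuclideanSpace ℝ (Fin n)) (_ : ‖x₀‖ = r),
                    condRisk (fun l t => d l t ω) σ xhat x₀) := by
  refine ⟨1 / (48 * (1 + M ^ 2)), by positivity, ?_⟩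
  intro C₀ k _ _ ε hε
  -- `n ≥ 3 > e` ensures `log n ≥ 1`.
  refine ⟨3, ?_⟩
  intro n hn L hL _ σ hσ μ hμ Ω _ P _ d hd
  have hlog : 1 ≤ Real.log n := by
    rw [Real.le_log_iff_exp_le (by exact_mod_cast (by omega : 0 < n))]
    have h3 : (3 : ℝ) ≤ n := by exact_mod_cast hn
    linarith [Real.exp_one_lt_d9]
  have hae := hd.ae_norm_le hμ
  obtain ⟨B, hBsub, hB, hB0⟩ := exists_measurable_superset_of_null (ae_iff.1 hae)
  refine ⟨Bᶜ, hB.compl, ?_, ?_⟩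
  · rw [probReal_compl_eq_one_sub hB, measureReal_def, hB0]
    simpa using hε.le
  intro ω hω
  have hbound : ∀ l t, ‖d l t ω‖ ≤ M := by
    by_contra h
    exact hω (hBsub h)
  refine ⟨le_iInf₂ fun xhat hx => ?_, fun hσn r hr => le_iInf₂ fun xhat hx => ?_⟩
  -- The single radius `r = σ + 1` suffices: it is admissible, and `(σ + 1)² ≥ σ` for every `σ > 0`.
  · have hr : 0 < σ + 1 := by linarith
    have h := minimax_le_iSup_condRisk (by omega) hL hbound hσ hr hlog
      (by nlinarith [mul_le_mul_of_nonneg_right hlog (sq_nonneg (σ + 1))]) hx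
    calc _ = ENNReal.ofReal (σ + 1) * _ := ?_
      _ ≤ _ := mul_le_mul_right h (ENNReal.ofReal (σ + 1))
      _ ≤ _ := ?_
    · rw [← ENNReal.ofReal_mul hr.le]
      congr 1
      field_simp
    · simp_rw [ENNReal.mul_iSup]
      refine iSup₂_le fun x₀ hx₀ => le_iSup₂_of_le x₀ (by rw [hx₀]; linarith) ?_
      rw [hx₀]
  · refine minimax_le_iSup_condRisk (by omega) hL hbound hσ (by linarith) hlog ?_ hx
    -- `r² log n ≥ σ · (σ log n) ≥ σ`; this is the role of `n ≥ exp (1/σ)`.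
    have h1 : σ ^ 2 ≤ r ^ 2 := by gcongr
    nlinarith [mul_le_mul_of_nonneg_left h1 (by linarith : 0 ≤ Real.log n)]
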